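/- **Setting.** Multi-indices are finitely supported sequences $\nu=(\nu_j)_{j\in\mathbb N}$ of nonnegative integers, compared componentwise, with $|\nu|=\sum_j\nu_j$, $\operatorname{supp}\nu=\{j:\nu_j\ne0\}$ and $|\nu|_0=\#\operatorname{supp}\nu$. A set $\Lambda$ of multi-indices is *downward closed* if $\nu\in\Lambda$ and $\mu\le\nu$ imply $\mu\in\Lambda$. For finite $\Lambda$ put $\operatorname{supp}\Lambda=\bigcup_{\nu\in\Lambda}\operatorname{supp}\nu$, $m(\Lambda)=\max_{\nu\in\Lambda}|\nu|$ and $d(\Lambda)=\max_{\nu\in\Lambda}|\nu|_0$ (both $0$ if $\Lambda=\emptyset$). Let $H_n(x)=\frac{(-1)^n}{\sqrt{n!}}\,e^{x^2/2}\frac{d^n}{dx^n}e^{-x^2/2}$ be the normalized probabilists' Hermite polynomials, $H_\nu(y)=\prod_{j\in\operatorname{supp}\nu}H_{\nu_j}(y_j)$ for $y\in\mathbb R^{\mathbb N}$, and $\gamma$ the countable product of standard Gaussian measures on $\mathbb R^{\mathbb N}$. A *ReLU network* of depth $L\ge0$ is a composition $\Phi=A_L\circ\sigma\circ A_{L-1}\circ\cdots\circ\sigma\circ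 A_0$ of affine maps $A_j(x)=W_jx+b_j$ between finite-dimensional spaces, where $\sigma(x)=\max\{x,0\}$ is applied componentwise; its size is the total number of nonzero entries of all weight matrices $W_j$ and bias vectors $b_j$. **Theorem 3.5.** There is an absolute constant $C>0$ such that for every finite downward closed set $\Lambda\neq\{0\}$ of finitely supported multi-indices and every $\varepsilon\in(0,e^{-1})$ there exists a ReLU network $\Phi=(\tilde H_{\varepsilon,\nu})_{\nu\in\Lambda}:\mathbb R^{\operatorname{supp}\Lambda}\to\mathbb R^{\Lambda}$ such that, regarding each $\tilde H_{\varepsilon,\nu}$ as a function of $(y_j)_{j\in\operatorname{supp}\Lambda}$ on $\mathbb R^{\mathbb N}$, $$\|H_\nu-\tilde H_{\varepsilon,\nu}\|_{L^2(\mathbb R^{\mathbb N},\gamma)}\le\varepsilon\qquad\text{for all }\nu\in\Lambda,$$ and, with $m=m(\Lambda)$ and $d=d(\Lambda)$, $$\operatorname{size}(\Phi)\le C\,|\Lambda|\,m^3\log(1+m)\,d^2\log(\varepsilon^{-1}),\qquad \operatorname{depth}(\Phi)\le C\,m\log(1+m)^2\,d\log(1+d)\log(\varepsilon^{-1}).$$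 -/

import Mathlib

open MeasureTheory ProbabilityTheory

/-! ### Feedforward neural networks -/

/-- A feedforward neural network (without skip connections) with input coordinates labelled by
`ι` and output coordinates labelled by `κ`: a chain of affine maps `x ↦ W x + b`, between two
consecutive ones of which the activation function is to be applied. Here `affine W b` is a network
with a single affine map, and `hidden W b Ψ` applies `x ↦ W x + b`, then the activation function
in each of the finitely many coordinates of the hidden layer `η`, then the network `Ψ`. -/
inductive NeuralNet (κ : Type) : Type → Type 1
  | affine {ι : Type} (W : Matrix κ ι ℝ) (b : κ → ℝ) : NeuralNet κ ι
  | hidden {ι η : Type} [Fintype η] (W : Matrix η ι ℝ) (b : η → ℝ) (Ψ : NeuralNet κ η) :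
      NeuralNet κ ι

namespace NeuralNet

/-- The map `A_L ∘ σ ∘ ⋯ ∘ σ ∘ A_0` realized by the network with activation function `σ`
(applied componentwise). -/
def eval {κ : Type} (σ : ℝ → ℝ) :
    {ι : Type} → [Fintype ι] → NeuralNet κ ι → (ι → ℝ) → (κ → ℝ)
  | _, _, affine W b, x => W.mulVec x + b
  | _, _, hidden W b Ψ, x => Ψ.eval σ (fun k => σ ((W.mulVec x + b) k))

/-- The depth `L`: the number of applications of the activation function. -/
def depth {κ : Type} : {ι : Type} → NeuralNet κ ι → ℕ
  | _, affine _ _ => 0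
  | _, hidden _ _ Ψ => Ψ.depth + 1

open Classical in
/-- The number of nonzero entries of a weight matrix plus that of a bias vector. -/
noncomputable def layerSize {ι κ : Type} [Fintype ι] [Fintype κ] (W : Matrix κ ι ℝ)
    (b : κ → ℝ) : ℕ :=
  (Finset.univ.filter (fun p : κ × ι => W p.1 p.2 ≠ 0)).card +
    (Finset.univ.filter (fun k : κ => b k ≠ 0)).card

/-- The size: the total number of nonzero weights and biases in all layers. -/
noncomputable def size {κ : Type} [Fintype κ] :
    {ι : Type} → [Fintype ι] → NeuralNet κ ι → ℕ
  | _, _, affine W b => layerSize W b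
  | _, _, hidden W b Ψ => layerSize W b + Ψ.size

end NeuralNet

/-- The ReLU activation function. -/
noncomputable def relu (x : ℝ) : ℝ := max x 0

/-! ### Multi-indices

Finitely supported multi-indices are elements `ν : ℕ →₀ ℕ`; the total order `|ν|` is
`Finsupp.degree ν = ∑ j ∈ ν.support, ν j`. -/

/-- The set `supp Λ` of all coordinates that occur in some `ν ∈ Λ`. -/
def indexSupport (Λ : Finset (ℕ →₀ ℕ)) : Finset ℕ := Λ.biUnion Finsupp.support

/-- The maximum order `m(Λ)`: the maximum of the total orders `|ν|`, `ν ∈ Λ`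
(zero if `Λ` is empty). -/
noncomputable def maxOrder (Λ : Finset (ℕ →₀ ℕ)) : ℕ := Λ.sup (fun ν => Finsupp.degree ν)

/-- The effective dimension `d(Λ)`: the maximum of the support sizes `|ν|₀`, `ν ∈ Λ`
(zero if `Λ` is empty). -/
def effectiveDim (Λ : Finset (ℕ →₀ ℕ)) : ℕ := Λ.sup (fun ν => ν.support.card)

/-! ### Hermite polynomials and the Gaussian measure -/

/-- The `n`-th probabilists' Hermite polynomial, normalized in `L²(ℝ, γ₁)`. -/
noncomputable def hermiteFun (n : ℕ) (x : ℝ) : ℝ :=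
  Polynomial.aeval x (Polynomial.hermite n) / Real.sqrt (n.factorial : ℝ)

/-- `H_n` is given by the Rodrigues formula. -/
theorem hermiteFun_eq_rodrigues (n : ℕ) (x : ℝ) :
    hermiteFun n x = (-1) ^ n / Real.sqrt (n.factorial : ℝ) * Real.exp (x ^ 2 / 2) *
      iteratedDeriv n (fun t : ℝ => Real.exp (-(t ^ 2 / 2))) x := by
  rw [hermiteFun, Polynomial.hermite_eq_deriv_gaussian', iteratedDeriv_eq_iterate]
  ring

/-- The tensorized Hermite polynomial `H_ν(y) = ∏_{j ∈ supp ν} H_{ν_j}(y_j)` on `ℝ^ℕ`. -/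
noncomputable def hermiteTensor (ν : ℕ →₀ ℕ) (y : ℕ → ℝ) : ℝ :=
  ∏ j ∈ ν.support, hermiteFun (ν j) (y j)

/-- The infinite product `γ` of standard Gaussian measures on `ℝ^ℕ`. -/
noncomputable def gaussianSeq : Measure (ℕ → ℝ) :=
  Measure.infinitePi (fun _ : ℕ => gaussianReal 0 1)

/-! The three-term recurrence of the Hermite polynomials is a product of 2 × 2 transfer matrices,
each affine in one variable. The block for degree `n` in one coordinate contains the factor with
recurrence coefficient 0, so its (0,1)-entry vanishes (for `n = 0` it is the identity). On such
lower triangular matrices the (0,0)-entry is multiplicative, hence `H_ν`, up to its normalization,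
is the (0,0)-entry of a product of `|ν|` transfer matrices (`hermiteTensor_eq`).

On the cube of side `2M` all factors have norm at most `Q = M + m + 1`. Divided by `Q` and padded by
identities to `2 ^ K ≥ m` factors, they are multiplied along a binary tree with approximate ReLU
multiplications. Each level enlarges the error by a factor of at most 4 (`norm_approxProd_sub_le`),
and undoing the scaling costs `Q ^ 2 ^ K`. As the error of one multiplication is of order `4 ^
(-S)`, some `S` of order `m log(1+m) log(1/ε)` suffices (`network_error_le`).

Outside the cube the inputs are clipped. Both `H_ν` and its clipped version grow at most like `m!
exp(m + 1 + ∑ |y_j|)`, and they differ only where `∑ |y_j| ≥ M`; trading one more exponential for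
`exp(-M)` leaves a Gaussian exponential moment (`abs_hermiteTensor_sub_clip_le`,
`eLpNorm_exp_two_mul_sum_abs_le`), so `M = 10 m ^ 2 + log(1/ε)` is enough.

The tree has `K (S + 2)` layers with `O(|Λ| m)` sparse neurons each. This gives the bounds already
without the factors in `d`, which are bounded below by positive constants. -/

/-! ### A calculus of sparse ReLU networks -/

namespace NeuralNet

/-- The number of nonzero weights and biases in the first affine map. -/
noncomputable def firstLayerSize {κ : Type} [Fintype κ] :
    {ι : Type} → [Fintype ι] → NeuralNet κ ι → ℕ
  | _, _, affine W b => layerSize W b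
  | _, _, hidden W b _ => layerSize W b

/-- Precompose a network with the linear map `x ↦ (e ↦ c e true * x (e, true) +
c e false * x (e, false))`, merged into the first affine map. -/
def decode {κ : Type} : {η : Type} → NeuralNet κ η → (η → Bool → ℝ) → NeuralNet κ (η × Bool)
  | _, affine W b, c => affine (fun k p => W k p.1 * c p.1 p.2) b
  | _, hidden W b Ψ, c => hidden (fun k p => W k p.1 * c p.1 p.2) b Ψ

theorem decode_mulVec {κ η : Type} [Fintype η] (W : Matrix κ η ℝ) (c : η → Bool → ℝ)
    (x : η × Bool → ℝ) :
    Matrix.mulVec (fun k (p : η × Bool) => W k p.1 * c p.1 p.2 : Matrix κ (η × Bool) ℝ) x =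
      W.mulVec (fun e => c e true * x (e, true) + c e false * x (e, false)) := by
  ext k
  simp only [Matrix.mulVec, dotProduct, Fintype.sum_prod_type, Fintype.sum_bool]
  exact Finset.sum_congr rfl fun e _ => by ring

theorem eval_decode {κ η : Type} [Fintype η] (Φ : NeuralNet κ η) (c : η → Bool → ℝ) (σ : ℝ → ℝ)
    (x : η × Bool → ℝ) :
    (Φ.decode c).eval σ x =
      Φ.eval σ (fun e => c e true * x (e, true) + c e false * x (e, false)) := by
  cases Φ <;> simp only [decode, eval, decode_mulVec]

theorem depth_decode {κ η : Type} (Φ : NeuralNet κ η) (c : η → Bool → ℝ) :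
    (Φ.decode c).depth = Φ.depth := by
  cases Φ <;> rfl

theorem layerSize_decode_le {κ η : Type} [Fintype η] [Fintype κ] (W : Matrix κ η ℝ)
    (b : κ → ℝ) (c : η → Bool → ℝ) :
    layerSize (fun k (p : η × Bool) => W k p.1 * c p.1 p.2) b ≤ 2 * layerSize W b := by
  classical
  unfold layerSize
  have h : (Finset.univ.filter
      (fun q : κ × (η × Bool) => W q.1 q.2.1 * c q.2.1 q.2.2 ≠ 0)).card ≤
      ((Finset.univ.filter (fun p : κ × η => W p.1 p.2 ≠ 0)) ×ˢ
        (Finset.univ : Finset Bool)).card := by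
    refine Finset.card_le_card_of_injOn (fun q => ((q.1, q.2.1), q.2.2)) ?_ ?_
    · intro q hq
      simp only [Finset.coe_filter, Finset.mem_univ, true_and, Set.mem_ofPred_eq] at hq
      simp [left_ne_zero_of_mul hq]
    · rintro ⟨a, b, c⟩ _ ⟨a', b', c'⟩ _ h
      simp only [Prod.mk.injEq] at h ⊢
      tauto
  rw [Finset.card_product, Finset.card_univ, Fintype.card_bool] at h
  convert Nat.add_le_add h (Nat.le_mul_of_pos_left _ two_pos) using 1
  ring

theorem size_decode_le {κ η : Type} [Fintype η] [Fintype κ] (Φ : NeuralNet κ η)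
    (c : η → Bool → ℝ) : (Φ.decode c).size ≤ Φ.size + Φ.firstLayerSize := by
  cases Φ with
  | affine W b =>
    simp only [decode, size, firstLayerSize]
    linarith [layerSize_decode_le W b c]
  | hidden W b Ψ =>
    simp only [decode, size, firstLayerSize]
    linarith [layerSize_decode_le W b c]

end NeuralNet

/-! ### Affine functions of few coordinates -/

open Classical in
/-- `g` is an affine function that depends on at most `R` coordinates. -/
def IsSparseAffine {ι : Type} [Fintype ι] (R : ℕ) (g : (ι → ℝ) → ℝ) : Prop :=
  ∃ (w : ι → ℝ) (b : ℝ), (Finset.univ.filter (fun i => w i ≠ 0)).card ≤ R ∧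
    ∀ x, g x = (∑ i, w i * x i) + b

namespace IsSparseAffine

variable {ι : Type} [Fintype ι] {R R' : ℕ} {g g' : (ι → ℝ) → ℝ}

theorem const (c : ℝ) : IsSparseAffine (ι := ι) 0 (fun _ => c) :=
  ⟨0, c, by simp, by simp⟩

theorem coord (i : ι) : IsSparseAffine 1 (fun x : ι → ℝ => x i) := by
  classical
  refine ⟨Pi.single i 1, 0, ?_, fun x => ?_⟩
  · refine (Finset.card_le_card (t := {i}) fun j hj => ?_).trans (by simp)
    by_contra h
    simp only [Finset.mem_singleton] at h
    simp [Pi.single_apply, h] at hj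
  · simp [Pi.single_apply]

theorem add (h : IsSparseAffine R g) (h' : IsSparseAffine R' g') :
    IsSparseAffine (R + R') (fun x => g x + g' x) := by
  classical
  obtain ⟨w, b, hw, hg⟩ := h
  obtain ⟨w', b', hw', hg'⟩ := h'
  refine ⟨w + w', b + b', ?_, fun x => ?_⟩
  · refine (Finset.card_le_card (t := Finset.univ.filter (fun i => w i ≠ 0) ∪
      Finset.univ.filter (fun i => w' i ≠ 0)) fun i hi => ?_).trans
      ((Finset.card_union_le _ _).trans (Nat.add_le_add ?_ ?_))
    · simp only [Finset.mem_filter, Finset.mem_univ, true_and, Finset.mem_union,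
        Pi.add_apply] at hi ⊢
      by_contra! h
      exact hi (by rw [h.1, h.2, add_zero])
    · convert hw
    · convert hw'
  · simp only [hg, hg', Pi.add_apply, add_mul, Finset.sum_add_distrib]
    ring

theorem const_mul (c : ℝ) (h : IsSparseAffine R g) : IsSparseAffine R (fun x => c * g x) := by
  classical
  obtain ⟨w, b, hw, hg⟩ := h
  refine ⟨c • w, c * b, (Finset.card_le_card fun i hi => ?_).trans hw, fun x => ?_⟩
  · simp only [Finset.mem_filter, Finset.mem_univ, true_and, Pi.smul_apply, smul_eq_mul] at hi ⊢
    exact right_ne_zero_of_mul hi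
  · simp only [hg, Pi.smul_apply, smul_eq_mul, mul_add, Finset.mul_sum, mul_assoc]

theorem mono (h : IsSparseAffine R g) (hR : R ≤ R') : IsSparseAffine R' g := by
  obtain ⟨w, b, hw, hg⟩ := h
  exact ⟨w, b, hw.trans hR, hg⟩

theorem congr (h : IsSparseAffine R g) (hg : ∀ x, g' x = g x) : IsSparseAffine R g' := by
  obtain rfl : g' = g := funext hg
  exact h

end IsSparseAffine

/-! ### Realization and composition of maps -/

theorem layerSize_le_of_sparse {ι κ : Type} [Fintype ι] [Fintype κ] {R : ℕ}
    (W : Matrix κ ι ℝ) (b : κ → ℝ)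
    (h : ∀ k, ({i | W k i ≠ 0} : Set ι).ncard ≤ R) :
    NeuralNet.layerSize W b ≤ Fintype.card κ * (R + 1) := by
  classical
  have h1 : (Finset.univ.filter (fun p : κ × ι => W p.1 p.2 ≠ 0)).card ≤ Fintype.card κ * R := by
    rw [Finset.card_filter, Fintype.sum_prod_type]
    simp only [← Finset.card_filter]
    refine (Finset.sum_le_card_nsmul _ _ R fun k _ => ?_).trans (by simp)
    refine le_trans (le_of_eq ?_) (h k)
    rw [← Set.ncard_coe_finset]
    congr 1
    ext i
    simp
  have h2 : (Finset.univ.filter (fun k : κ => b k ≠ 0)).card ≤ Fintype.card κ :=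
    Finset.card_filter_le _ _
  unfold NeuralNet.layerSize
  convert Nat.add_le_add h1 h2 using 1
  ring

/-- `f` is realized by a ReLU network of depth `L` whose size, with the first affine map counted
twice, is at most `S`. -/
def IsRealized {ι κ : Type} [Fintype ι] [Fintype κ] (L S : ℕ) (f : (ι → ℝ) → κ → ℝ) : Prop :=
  ∃ Φ : NeuralNet κ ι, (∀ x, Φ.eval relu x = f x) ∧ Φ.depth = L ∧
    Φ.size + Φ.firstLayerSize ≤ S

/-- Every coordinate of `f` has the form `α relu(g) + β relu(-g)` with an affine function `g` of
at most `R` coordinates. -/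
def IsReluStep {ι κ : Type} [Fintype ι] (R : ℕ) (f : (ι → ℝ) → κ → ℝ) : Prop :=
  ∀ k, ∃ g, IsSparseAffine R g ∧ ∃ α β : ℝ, ∀ x, f x k = α * relu (g x) + β * relu (-g x)

theorem relu_sub_relu_neg (a : ℝ) : relu a - relu (-a) = a := by
  unfold relu
  rcases le_total a 0 with h | h
  · rw [max_eq_right h, max_eq_left (by linarith)]; ring
  · rw [max_eq_left h, max_eq_right (by linarith)]; ring

theorem relu_add_relu_neg (a : ℝ) : relu a + relu (-a) = |a| := by
  unfold relu
  rcases le_total a 0 with h | h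
  · rw [max_eq_right h, max_eq_left (by linarith), abs_of_nonpos h]; ring
  · rw [max_eq_left h, max_eq_right (by linarith), abs_of_nonneg h]; ring

/-- Since `a = relu a - relu (-a)`, a layer can also transmit affine quantities unchanged. -/
theorem IsReluStep.of_affine {ι κ : Type} [Fintype ι] {R : ℕ} {f : (ι → ℝ) → κ → ℝ}
    (h : ∀ k, IsSparseAffine R (fun x => f x k)) : IsReluStep R f := fun k =>
  ⟨_, h k, 1, -1, fun x => by linarith [relu_sub_relu_neg (f x k)]⟩

theorem ncard_ne_zero_eq {ι : Type} [Fintype ι] (w : ι → ℝ) [DecidablePred fun i => w i ≠ 0] :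
    ({i | w i ≠ 0} : Set ι).ncard = (Finset.univ.filter (fun i => w i ≠ 0)).card := by
  rw [← Set.ncard_coe_finset]
  congr 1
  ext i
  simp

theorem isRealized_affine {ι κ : Type} [Fintype ι] [Fintype κ] {R : ℕ} {f : (ι → ℝ) → κ → ℝ}
    (h : ∀ k, IsSparseAffine R (fun x => f x k)) :
    IsRealized 0 (2 * (Fintype.card κ * (R + 1))) f := by
  classical
  choose w b hw hf using h
  refine ⟨.affine w b, fun x => ?_, rfl, ?_⟩
  · ext k
    simp [NeuralNet.eval, Matrix.mulVec, dotProduct, hf]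
  · have := layerSize_le_of_sparse (R := R) w b fun k => by
      rw [ncard_ne_zero_eq]; convert hw k
    simp only [NeuralNet.size, NeuralNet.firstLayerSize]
    omega

/-- The two neurons `relu (g)` and `relu (-g)` serve each coordinate, and their recombination with
`α`, `β` is merged into the next affine map. The merging at most doubles the nonzero weights of that
map, which is already paid for because the first layer is counted twice. The new first layer, with
`2 |η|` neurons, is in turn counted twice: hence the 4. -/
theorem IsRealized.comp_step {ι η κ : Type} [Fintype ι] [Fintype η] [Fintype κ] {L S R : ℕ}
    {g : (η → ℝ) → κ → ℝ} (hg : IsRealized L S g) {f : (ι → ℝ) → η → ℝ} (hf : IsReluStep R f) :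
    IsRealized (L + 1) (S + 4 * (Fintype.card η * (R + 1))) (fun x => g (f x)) := by
  classical
  obtain ⟨Φ, he, hd, hs⟩ := hg
  choose u hu α β hf using hf
  choose w b hw hu using hu
  let W : Matrix (η × Bool) ι ℝ := fun p i => if p.2 then w p.1 i else - w p.1 i
  let B : η × Bool → ℝ := fun p => if p.2 then b p.1 else - b p.1
  refine ⟨.hidden W B (Φ.decode fun e s => if s then α e else β e), fun x => ?_, ?_, ?_⟩
  · rw [NeuralNet.eval, NeuralNet.eval_decode, he]
    congr 1
    ext e
    rw [hf]
    simp only [W, B, Pi.add_apply, Matrix.mulVec, dotProduct, if_true, hu,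
      Bool.false_eq_true, if_false, neg_mul, Finset.sum_neg_distrib, neg_add]
  · simp [NeuralNet.depth, NeuralNet.depth_decode, hd]
  · have h1 := layerSize_le_of_sparse (R := R) W B fun p => by
      refine le_trans (le_of_eq ?_) (hw p.1)
      rw [← ncard_ne_zero_eq]
      congr 1
      ext i
      rcases p with ⟨e, _ | _⟩ <;> simp [W]
    have h2 := NeuralNet.size_decode_le Φ fun e s => if s then α e else β e
    rw [Fintype.card_prod, Fintype.card_bool] at h1
    simp only [NeuralNet.size, NeuralNet.firstLayerSize]
    linarith

/-- Precomposition with `f` preserves realizability, at the cost of `L` in depth and `S` in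
size. -/
def IsReluChain {ι η : Type} [Fintype ι] [Fintype η] (L S : ℕ) (f : (ι → ℝ) → η → ℝ) : Prop :=
  ∀ (κ : Type) [Fintype κ] (g : (η → ℝ) → κ → ℝ) (L' S' : ℕ), IsRealized L' S' g →
    IsRealized (L' + L) (S' + S) (fun x => g (f x))

namespace IsReluChain

variable {ι η θ : Type} [Fintype ι] [Fintype η] [Fintype θ] {L L' S S' : ℕ}

theorem id : IsReluChain 0 0 (fun x : ι → ℝ => x) := fun _ _ _ _ _ hg => hg

theorem of_step {R : ℕ} {f : (ι → ℝ) → η → ℝ} (hf : IsReluStep R f) :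
    IsReluChain 1 (4 * (Fintype.card η * (R + 1))) f :=
  fun _ _ _ _ _ hg => hg.comp_step hf

/-- Defining the cost through precomposition with an arbitrary realized map makes depth and size
exactly additive. -/
theorem comp {g : (η → ℝ) → θ → ℝ} {f : (ι → ℝ) → η → ℝ} (hg : IsReluChain L S g)
    (hf : IsReluChain L' S' f) : IsReluChain (L + L') (S + S') (fun x => g (f x)) := by
  intro κ _ h Lh Sh hh
  have := hf _ _ _ _ (hg _ _ _ _ hh)
  rwa [add_assoc, add_assoc] at this

theorem mono_size {f : (ι → ℝ) → η → ℝ} (hf : IsReluChain L S f) (hS : S ≤ S') :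
    IsReluChain L S' f := by
  intro κ _ h Lh Sh hh
  obtain ⟨Φ, h1, h2, h3⟩ := hf _ _ _ _ hh
  exact ⟨Φ, h1, h2, by omega⟩

theorem congr {f f' : (ι → ℝ) → η → ℝ} (hf : IsReluChain L S f) (h : ∀ x, f' x = f x) :
    IsReluChain L S f' := by
  obtain rfl : f' = f := funext h
  exact hf

end IsReluChain

/-! ### Approximate squaring and multiplication -/

/-- The iterated tent map `t ↦ |2 t - 1|`. -/
noncomputable def tentIter (s : ℕ) (t : ℝ) : ℝ := (fun t => |2 * t - 1|)^[s] t

/-- The approximation of `t ^ 2` on `[0, 1]` by partial sums of iterated tent maps. -/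
noncomputable def approxSq (S : ℕ) (t : ℝ) : ℝ :=
  ∑ s ∈ Finset.range S, (1 / 4 : ℝ) ^ s * (tentIter s t - 1 / 4)

theorem tentIter_succ (s : ℕ) (t : ℝ) : tentIter (s + 1) t = |2 * tentIter s t - 1| :=
  Function.iterate_succ_apply' _ _ _

theorem tentIter_mem (s : ℕ) {t : ℝ} (ht : t ∈ Set.Icc (0 : ℝ) 1) :
    tentIter s t ∈ Set.Icc (0 : ℝ) 1 := by
  induction s with
  | zero => exact ht
  | succ s ih =>
    rw [tentIter_succ]
    exact ⟨abs_nonneg _, abs_le.2 ⟨by linarith [ih.1], by linarith [ih.2]⟩⟩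

/-- Telescoping of `u ^ 2 = (u - 1/4) + (1/4) |2 u - 1| ^ 2` along the tent iterates. -/
theorem approxSq_add (S : ℕ) (t : ℝ) :
    approxSq S t + (1 / 4) ^ S * tentIter S t ^ 2 = t ^ 2 := by
  induction S with
  | zero => simp [approxSq, tentIter]
  | succ S ih =>
    rw [approxSq, Finset.sum_range_succ, ← approxSq, tentIter_succ, sq_abs, ← ih, pow_succ]
    ring

theorem abs_approxSq_sub_le (S : ℕ) {t : ℝ} (ht : t ∈ Set.Icc (0 : ℝ) 1) :
    |approxSq S t - t ^ 2| ≤ (1 / 4) ^ S := by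
  have h := approxSq_add S t
  have h1 := tentIter_mem S ht
  have h2 : tentIter S t ^ 2 ≤ 1 := pow_le_one₀ h1.1 h1.2
  have h3 : (0 : ℝ) ≤ (1 / 4) ^ S := by positivity
  rw [show approxSq S t - t ^ 2 = -((1 / 4) ^ S * tentIter S t ^ 2) by linarith, abs_neg,
    abs_of_nonneg (by positivity)]
  exact mul_le_of_le_one_right h3 h2

/-- The approximation of `a * b` for `|a|, |b| ≤ 2` by polarization. -/
noncomputable def approxMul (S : ℕ) (a b : ℝ) : ℝ :=
  4 * (approxSq S |(a + b) / 4| - approxSq S |(a - b) / 4|)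

/-- Polarization, `a b = 4 (((a + b)/4) ^ 2 - ((a - b)/4) ^ 2)`, has arguments in `[-1, 1]` here.
The range 2 leaves room for perturbed entries of matrices of norm at most 1. -/
theorem abs_approxMul_sub_le (S : ℕ) {a b : ℝ} (ha : |a| ≤ 2) (hb : |b| ≤ 2) :
    |approxMul S a b - a * b| ≤ 8 * (1 / 4) ^ S := by
  obtain ⟨ha1, ha2⟩ := abs_le.1 ha
  obtain ⟨hb1, hb2⟩ := abs_le.1 hb
  have h1 := abs_le.1 (abs_approxSq_sub_le S (t := |(a + b) / 4|)
    ⟨abs_nonneg _, abs_le.2 ⟨by linarith, by linarith⟩⟩)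
  have h2 := abs_le.1 (abs_approxSq_sub_le S (t := |(a - b) / 4|)
    ⟨abs_nonneg _, abs_le.2 ⟨by linarith, by linarith⟩⟩)
  rw [sq_abs] at h1 h2
  rw [approxMul, abs_le]
  constructor <;> nlinarith [h1.1, h1.2, h2.1, h2.2]

/-- Each layer carries the pair (partial sum, current tent iterate). The first layer produces `|u|`,
the zeroth iterate; every further layer adds one summand. Updating the partial sum reads two
coordinates, whence `2 ≤ R`. -/
theorem isReluChain_approxSq {E ι : Type} [Fintype E] [Fintype ι] {R : ℕ} (hR : 2 ≤ R)
    {u : E → (ι → ℝ) → ℝ} (hu : ∀ e, IsSparseAffine R (u e)) (S : ℕ) :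
    IsReluChain (S + 1) ((S + 1) * (8 * (Fintype.card E * (R + 1))))
      (fun (x : ι → ℝ) (p : E × Bool) =>
        if p.2 then approxSq S |u p.1 x| else tentIter S |u p.1 x|) := by
  have hcard : Fintype.card (E × Bool) = 2 * Fintype.card E := by
    rw [Fintype.card_prod, Fintype.card_bool, mul_comm]
  induction S with
  | zero =>
    refine (IsReluChain.of_step (R := R) ?_).mono_size (by rw [hcard]; apply le_of_eq; ring)
    rintro ⟨e, _ | _⟩
    · exact ⟨u e, hu e, 1, 1, fun x => by
        simp [tentIter, ← relu_add_relu_neg]⟩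
    · exact ⟨_, (IsSparseAffine.const 0).mono (Nat.zero_le _), 0, 0, fun x => by
        simp [approxSq]⟩
  | succ S ih =>
    let f : (E × Bool → ℝ) → E × Bool → ℝ := fun x p =>
      if p.2 then x (p.1, true) + (1 / 4 : ℝ) ^ S * (x (p.1, false) - 1 / 4)
      else |2 * x (p.1, false) - 1|
    have hf : IsReluStep R f := by
      rintro ⟨e, _ | _⟩
      · refine ⟨fun x => 2 * x (e, false) + -1,
          (((IsSparseAffine.coord _).const_mul 2).add (.const (-1))).mono (by omega),
          1, 1, fun x => ?_⟩
        simp only [f, one_mul, relu_add_relu_neg]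
        rfl
      · refine ⟨fun x => x (e, true) + (1 / 4 : ℝ) ^ S * (x (e, false) + -(1 / 4)),
          ((IsSparseAffine.coord _).add (((IsSparseAffine.coord _).add
            (.const _)).const_mul _)).mono (by omega), 1, -1, fun x => ?_⟩
        rw [one_mul, neg_one_mul, ← sub_eq_add_neg, relu_sub_relu_neg]
        simp [f, sub_eq_add_neg]
    have h := ((IsReluChain.of_step hf).comp ih).mono_size
      (S' := (S + 1 + 1) * (8 * (Fintype.card E * (R + 1)))) (by
        rw [hcard]; apply le_of_eq; ring)
    rw [add_comm 1] at h
    refine h.congr fun x => funext ?_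
    rintro ⟨e, _ | _⟩
    · simp [f, tentIter_succ]
    · simp [f, approxSq, Finset.sum_range_succ]

/-! ### Approximate products of `2 × 2` matrices -/

/-- The approximation of a product of two matrices. -/
noncomputable def approxMatMul (S : ℕ) (A B : Matrix (Fin 2) (Fin 2) ℝ) :
    Matrix (Fin 2) (Fin 2) ℝ :=
  Matrix.of fun i k => ∑ r, approxMul S (A i r) (B r k)

/-- The approximation of `f 0 * f 1 * ⋯ * f (2 ^ K - 1)` along a binary tree. -/
noncomputable def approxProd (S : ℕ) :
    ℕ → (ℕ → Matrix (Fin 2) (Fin 2) ℝ) → Matrix (Fin 2) (Fin 2) ℝ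
  | 0, f => f 0
  | K + 1, f => approxProd S K fun p => approxMatMul S (f (2 * p)) (f (2 * p + 1))

theorem approxProd_congr (S K : ℕ) {f g : ℕ → Matrix (Fin 2) (Fin 2) ℝ}
    (h : ∀ p < 2 ^ K, f p = g p) : approxProd S K f = approxProd S K g := by
  induction K generalizing f g with
  | zero => exact h 0 (by simp)
  | succ K ih =>
    refine ih fun p hp => ?_
    rw [pow_succ] at h
    rw [h _ (by omega), h _ (by omega)]

theorem prod_range_two_mul {M : Type*} [Monoid M] (f : ℕ → M) (n : ℕ) :
    ((List.range (2 * n)).map f).prod =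
      ((List.range n).map fun p => f (2 * p) * f (2 * p + 1)).prod := by
  induction n with
  | zero => simp
  | succ n ih =>
    rw [show 2 * (n + 1) = 2 * n + 1 + 1 by ring, List.prod_range_succ, List.prod_range_succ, ih,
      List.prod_range_succ, mul_assoc]

section

attribute [local instance] Matrix.linftyOpNormedRing

theorem Matrix.sum_abs_le_linftyOpNorm (A : Matrix (Fin 2) (Fin 2) ℝ) (i : Fin 2) :
    |A i 0| + |A i 1| ≤ ‖A‖ := by
  rw [Matrix.linfty_opNorm_def]
  have := Finset.le_sup (f := fun i => ∑ j, ‖A i j‖₊) (Finset.mem_univ i)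
  have := NNReal.coe_le_coe.2 this
  simpa using this

theorem Matrix.abs_le_linftyOpNorm (A : Matrix (Fin 2) (Fin 2) ℝ) (i j : Fin 2) :
    |A i j| ≤ ‖A‖ := by
  have := Matrix.sum_abs_le_linftyOpNorm A i
  fin_cases j
  · exact (le_add_of_nonneg_right (abs_nonneg _)).trans this
  · exact (le_add_of_nonneg_left (abs_nonneg _)).trans this

theorem Matrix.linftyOpNorm_le_of_sum_abs_le {A : Matrix (Fin 2) (Fin 2) ℝ} {c : ℝ}
    (h : ∀ i, |A i 0| + |A i 1| ≤ c) : ‖A‖ ≤ c := by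
  have hc : 0 ≤ c := le_trans (by positivity) (h 0)
  lift c to NNReal using hc
  rw [Matrix.linfty_opNorm_def, NNReal.coe_le_coe]
  refine Finset.sup_le fun i _ => ?_
  rw [← NNReal.coe_le_coe]
  simpa using h i

/-- Perturbing the factors costs `e (1 + e) + e ≤ 3 e`. Each entry uses two approximate
multiplications and each row has two entries, so the arithmetic error is `4 * 8 * (1/4) ^ S`. -/
theorem norm_approxMatMul_sub_le (S : ℕ) {A B A' B' : Matrix (Fin 2) (Fin 2) ℝ} {e : ℝ}
    (hA : ‖A‖ ≤ 1) (hB : ‖B‖ ≤ 1) (he : e ≤ 1) (hA' : ‖A' - A‖ ≤ e) (hB' : ‖B' - B‖ ≤ e) :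
    ‖approxMatMul S A' B' - A * B‖ ≤ 3 * e + 32 * (1 / 4) ^ S := by
  have hA1 : ‖A'‖ ≤ 1 + e := by
    calc ‖A'‖ = ‖A + (A' - A)‖ := by rw [add_sub_cancel]
      _ ≤ 1 + e := (norm_add_le _ _).trans (add_le_add hA hA')
  have hB1 : ‖B'‖ ≤ 1 + e := by
    calc ‖B'‖ = ‖B + (B' - B)‖ := by rw [add_sub_cancel]
      _ ≤ 1 + e := (norm_add_le _ _).trans (add_le_add hB hB')
  have hab : ∀ i k, |(approxMatMul S A' B' - A' * B') i k| ≤ 16 * (1 / 4) ^ S := fun i k => by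
    have h (r : Fin 2) : |approxMul S (A' i r) (B' r k) - A' i r * B' r k| ≤ 8 * (1 / 4) ^ S :=
      abs_approxMul_sub_le S
        ((Matrix.abs_le_linftyOpNorm A' i r).trans (by linarith))
        ((Matrix.abs_le_linftyOpNorm B' r k).trans (by linarith))
    have h0 := abs_le.1 (h 0)
    have h1 := abs_le.1 (h 1)
    rw [Matrix.sub_apply, Matrix.mul_apply, approxMatMul, Matrix.of_apply, Fin.sum_univ_two,
      Fin.sum_univ_two, abs_le]
    constructor <;> linarith [h0.1, h0.2, h1.1, h1.2]
  have h1 : ‖approxMatMul S A' B' - A' * B'‖ ≤ 32 * (1 / 4) ^ S :=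
    Matrix.linftyOpNorm_le_of_sum_abs_le fun i => by linarith [hab i 0, hab i 1]
  have he0 : 0 ≤ e := (norm_nonneg _).trans hA'
  calc ‖approxMatMul S A' B' - A * B‖
      = ‖(approxMatMul S A' B' - A' * B') + (A' - A) * B' + A * (B' - B)‖ := by
        congr 1; noncomm_ring
    _ ≤ ‖approxMatMul S A' B' - A' * B'‖ + ‖(A' - A) * B'‖ + ‖A * (B' - B)‖ := norm_add₃_le
    _ ≤ 32 * (1 / 4) ^ S + e * (1 + e) + 1 * e := by
        gcongr
        · exact (norm_mul_le _ _).trans (by gcongr)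
        · exact (norm_mul_le _ _).trans (by gcongr)
    _ ≤ 3 * e + 32 * (1 / 4) ^ S := by nlinarith

/-- With `δ = 32 * (1/4) ^ S`, one level turns `e` into `3 e + δ`, so `e + δ` grows to at most `4 (e
+ δ)`. The smallness hypothesis keeps `e ≤ 1` at every level, where the multiplication is accurate.
-/
theorem norm_approxProd_sub_le (S K : ℕ) {f g : ℕ → Matrix (Fin 2) (Fin 2) ℝ} {e : ℝ}
    (he : 0 ≤ e) (hg : ∀ p, ‖g p‖ ≤ 1) (hfg : ∀ p, ‖f p - g p‖ ≤ e)
    (h : 4 ^ K * (e + 32 * (1 / 4) ^ S) ≤ 1) :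
    ‖approxProd S K f - ((List.range (2 ^ K)).map g).prod‖ ≤
      4 ^ K * (e + 32 * (1 / 4) ^ S) := by
  induction K generalizing f g e with
  | zero =>
    have : (0 : ℝ) ≤ 32 * (1 / 4) ^ S := by positivity
    simp only [approxProd, pow_zero, List.range_one, List.map_cons, List.map_nil, List.prod_cons,
      List.prod_nil, mul_one, one_mul]
    linarith [hfg 0]
  | succ K ih =>
    have hδ : (0 : ℝ) ≤ 32 * (1 / 4) ^ S := by positivity
    have h4 : (4 : ℝ) ^ K * (3 * e + 32 * (1 / 4) ^ S + 32 * (1 / 4) ^ S) ≤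
        4 ^ (K + 1) * (e + 32 * (1 / 4) ^ S) := by
      rw [pow_succ, mul_assoc]
      gcongr
      linarith
    have he1 : e ≤ 1 := by
      have : (1 : ℝ) ≤ 4 ^ (K + 1) := one_le_pow₀ (by norm_num)
      nlinarith
    rw [pow_succ' 2 K, prod_range_two_mul]
    refine (ih (by positivity) (fun p => ?_) (fun p => ?_) (h4.trans h)).trans h4
    · exact (norm_mul_le _ _).trans (mul_le_one₀ (hg _) (norm_nonneg _) (hg _))
    · exact norm_approxMatMul_sub_le S (hg _) (hg _) he1 (hfg _) (hfg _)

end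

/-- The sequence of matrices with entries stored in `x`. -/
def matrixSeq {I : Type} {n : ℕ} (x : I × Fin n × Fin 2 × Fin 2 → ℝ) (i : I) (p : ℕ) :
    Matrix (Fin 2) (Fin 2) ℝ :=
  if h : p < n then Matrix.of fun a b => x (i, ⟨p, h⟩, a, b) else 0

theorem isReluChain_approxMatMul {I : Type} [Fintype I] (S n : ℕ) :
    IsReluChain (S + 2) ((S + 2) * (640 * (Fintype.card I * n)))
      (fun (x : I × Fin (n * 2) × Fin 2 × Fin 2 → ℝ) (q : I × Fin n × Fin 2 × Fin 2) =>
        approxMatMul S (matrixSeq x q.1 (2 * q.2.1)) (matrixSeq x q.1 (2 * q.2.1 + 1))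
          q.2.2.1 q.2.2.2) := by
  -- One squaring per output entry, summation index and sign of the polarization: 16 per product,
  -- hence `640 = 8 * 16 * 5`. The recombining layer costs only 80.
  let E := (I × Fin n × Fin 2 × Fin 2) × Fin 2 × Bool
  let u : E → (I × Fin (n * 2) × Fin 2 × Fin 2 → ℝ) → ℝ := fun e x =>
    1 / 4 * (x (e.1.1, ⟨2 * e.1.2.1, by omega⟩, e.1.2.2.1, e.2.1) +
      (if e.2.2 then 1 else -1) * x (e.1.1, ⟨2 * e.1.2.1 + 1, by omega⟩, e.2.1, e.1.2.2.2))
  have hu : ∀ e, IsSparseAffine 4 (u e) := fun e =>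
    (((IsSparseAffine.coord _).add ((IsSparseAffine.coord _).const_mul _)).const_mul _).mono
      (by norm_num)
  have h1 := isReluChain_approxSq (by norm_num) hu S
  let f : (E × Bool → ℝ) → I × Fin n × Fin 2 × Fin 2 → ℝ := fun x q =>
    4 * ((x ((q, 0, true), true) + (-1) * x ((q, 0, false), true)) +
      (x ((q, 1, true), true) + (-1) * x ((q, 1, false), true)))
  have hf : IsReluStep 4 f := .of_affine fun q =>
    ((((IsSparseAffine.coord _).add ((IsSparseAffine.coord _).const_mul _)).add
      ((IsSparseAffine.coord _).add ((IsSparseAffine.coord _).const_mul _))).const_mul _).mono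
      (by norm_num)
  have h2 := (IsReluChain.of_step hf).comp h1
  rw [show 1 + (S + 1) = S + 2 by ring] at h2
  refine (h2.mono_size ?_).congr fun x => funext fun q => ?_
  · simp only [E, Fintype.card_prod, Fintype.card_fin, Fintype.card_bool]
    calc _ = 640 * (S + 1) * (Fintype.card I * n) + 80 * (Fintype.card I * n) := by ring
      _ ≤ 640 * (S + 1) * (Fintype.card I * n) + 640 * (Fintype.card I * n) := by gcongr; norm_num
      _ = _ := by ring
  · obtain ⟨i, p, a, b⟩ := q
    have hp1 : 2 * (p : ℕ) < n * 2 := by omega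
    have hp2 : 2 * (p : ℕ) + 1 < n * 2 := by omega
    simp only [approxMatMul, matrixSeq, hp1, hp2, dif_pos, Matrix.of_apply, Fin.sum_univ_two,
      approxMul, f, u, if_true, Bool.false_eq_true, if_false]
    have e1 (a b : ℝ) : 1 / 4 * (a + 1 * b) = (a + b) / 4 := by ring
    have e2 (a b : ℝ) : 1 / 4 * (a + -1 * b) = (a - b) / 4 := by ring
    simp only [e1, e2]
    ring

theorem isReluChain_approxProd {I : Type} [Fintype I] (S K : ℕ) :
    IsReluChain (K * (S + 2)) (K * ((S + 2) * (640 * (Fintype.card I * 2 ^ K))))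
      (fun (x : I × Fin (2 ^ K) × Fin 2 × Fin 2 → ℝ) (q : I × Fin (2 ^ 0) × Fin 2 × Fin 2) =>
        approxProd S K (matrixSeq x q.1) q.2.2.1 q.2.2.2) := by
  induction K with
  | zero =>
    rw [zero_mul, zero_mul]
    refine IsReluChain.id.congr fun x => funext fun q => ?_
    obtain ⟨i, p, a, b⟩ := q
    have hp : p = ⟨0, by norm_num⟩ := Subsingleton.elim (α := Fin 1) _ _
    subst hp
    simp [approxProd, matrixSeq]
  | succ K ih =>
    have h := ih.comp (isReluChain_approxMatMul (I := I) S (2 ^ K))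
    rw [show K * (S + 2) + (S + 2) = (K + 1) * (S + 2) by ring] at h
    refine (h.mono_size ?_).congr fun x => funext fun q => ?_
    · rw [pow_succ]
      generalize Fintype.card I = c
      generalize 2 ^ K = t
      have : K * ((S + 2) * (640 * (c * t))) ≤ K * ((S + 2) * (640 * (c * (t * 2)))) := by
        gcongr; omega
      have : (S + 2) * (640 * (c * t)) ≤ (S + 2) * (640 * (c * (t * 2))) := by
        gcongr; omega
      linarith
    · rw [approxProd]
      refine congr_fun (congr_fun (approxProd_congr S K fun p hp => ?_) _) _
      conv_rhs => rw [matrixSeq, dif_pos hp]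
      rfl

/-! ### Hermite polynomials as matrix products -/

section

open Polynomial

theorem derivative_hermite_succ (n : ℕ) :
    derivative (hermite (n + 1)) = (n + 1 : ℤ[X]) * hermite n := by
  induction n with
  | zero => simp
  | succ n ih =>
    rw [hermite_succ, derivative_sub, derivative_mul, derivative_X, ih, derivative_mul]
    simp only [derivative_add, derivative_natCast, derivative_one]
    rw [hermite_succ n]
    push_cast
    ring

theorem hermite_succ_succ (n : ℕ) :
    hermite (n + 2) = X * hermite (n + 1) - (n + 1 : ℤ[X]) * hermite n := by
  rw [hermite_succ, derivative_hermite_succ]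

end

/-- The transfer matrix of the three-term recurrence of the Hermite polynomials. -/
def hermiteStep (n : ℕ) (x : ℝ) : Matrix (Fin 2) (Fin 2) ℝ := !![x, -n; 1, 0]

/-- The product `hermiteStep (k - 1) x * ⋯ * hermiteStep 0 x`. -/
noncomputable def hermiteBlock (k : ℕ) (x : ℝ) : Matrix (Fin 2) (Fin 2) ℝ :=
  ((List.range k).reverse.map fun n => hermiteStep n x).prod

theorem hermiteBlock_succ (k : ℕ) (x : ℝ) :
    hermiteBlock (k + 1) x = hermiteStep k x * hermiteBlock k x := by
  simp [hermiteBlock, List.range_succ]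

/-- The rightmost factor `hermiteStep 0 x` has zero second column because its coefficient is `-0`;
the first column `(x, 1)` then evolves by the three-term recurrence. -/
theorem hermiteBlock_succ_eq (k : ℕ) (x : ℝ) :
    hermiteBlock (k + 1) x = !![Polynomial.aeval x (Polynomial.hermite (k + 1)), 0;
      Polynomial.aeval x (Polynomial.hermite k), 0] := by
  induction k with
  | zero =>
    simp [hermiteBlock, hermiteStep]
  | succ k ih =>
    rw [hermiteBlock_succ, ih, hermiteStep, hermite_succ_succ]
    ext i j
    fin_cases i <;> fin_cases j <;> simp [Matrix.mul_apply, Fin.sum_univ_two]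
    ring

theorem hermiteBlock_apply_zero_zero (k : ℕ) (x : ℝ) :
    hermiteBlock k x 0 0 = Polynomial.aeval x (Polynomial.hermite k) := by
  cases k with
  | zero => simp [hermiteBlock]
  | succ k => simp [hermiteBlock_succ_eq]

theorem hermiteBlock_apply_zero_one (k : ℕ) (x : ℝ) : hermiteBlock k x 0 1 = 0 := by
  cases k with
  | zero => simp [hermiteBlock]
  | succ k => simp [hermiteBlock_succ_eq]

/-- Such matrices are lower triangular, so blocks belonging to different coordinates multiply like
scalars in the corner. -/
theorem prod_apply_zero_zero {l : List (Matrix (Fin 2) (Fin 2) ℝ)} (h : ∀ A ∈ l, A 0 1 = 0) :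
    l.prod 0 0 = (l.map fun A => A 0 0).prod := by
  induction l with
  | nil => simp
  | cons A l ih =>
    simp only [List.prod_cons, List.map_cons, Matrix.mul_apply, Fin.sum_univ_two,
      h A List.mem_cons_self, zero_mul, add_zero]
    rw [ih fun B hB => h B (List.mem_cons_of_mem _ hB)]

/-- The list of pairs `(j, n)`, `n < ν j`, that index the factors of the matrix product which
represents the tensorized Hermite polynomial. -/
noncomputable def factorList (ν : ℕ →₀ ℕ) : List (ℕ × ℕ) :=
  ν.support.toList.flatMap fun j => (List.range (ν j)).reverse.map fun n => (j, n)

theorem length_factorList (ν : ℕ →₀ ℕ) : (factorList ν).length = ν.degree := by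
  simp [factorList, List.length_flatMap, Finsupp.degree_apply]

theorem mem_factorList {ν : ℕ →₀ ℕ} {q : ℕ × ℕ} (h : q ∈ factorList ν) :
    q.1 ∈ ν.support ∧ q.2 + 1 ≤ ν.degree := by
  simp only [factorList, List.mem_flatMap, Finset.mem_toList, List.mem_map, List.mem_reverse,
    List.mem_range] at h
  obtain ⟨j, hj, n, hn, rfl⟩ := h
  exact ⟨hj, hn.trans_le (Finsupp.le_degree j ν)⟩

/-- The factors of the matrix product which represents the tensorized Hermite polynomial,
padded by identity matrices. -/
noncomputable def factorMatrix (ν : ℕ →₀ ℕ) (p : ℕ) (y : ℕ → ℝ) : Matrix (Fin 2) (Fin 2) ℝ :=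
  if h : p < (factorList ν).length then
    hermiteStep ((factorList ν)[p]).2 (y ((factorList ν)[p]).1) else 1

theorem prod_factorMatrix {ν : ℕ →₀ ℕ} {N : ℕ} (hN : ν.degree ≤ N) (y : ℕ → ℝ) :
    ((List.range N).map fun p => factorMatrix ν p y).prod =
      ((factorList ν).map fun q => hermiteStep q.2 (y q.1)).prod := by
  rw [← length_factorList] at hN
  obtain ⟨r, rfl⟩ := Nat.exists_eq_add_of_le hN
  rw [List.range_add, List.map_append, List.prod_append, List.map_map]
  have h1 : ((List.range r).map ((fun p => factorMatrix ν p y) ∘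
      fun x => (factorList ν).length + x)).prod = 1 :=
    List.prod_eq_one fun A hA => by
      obtain ⟨p, -, rfl⟩ := List.mem_map.1 hA
      simp [factorMatrix]
  rw [h1, mul_one]
  congr 1
  refine List.ext_getElem (by simp) fun i h1 h2 => ?_
  simp only [List.length_map, List.length_range] at h1
  simp [factorMatrix, h1]

theorem prod_factorList_apply (ν : ℕ →₀ ℕ) (y : ℕ → ℝ) :
    ((factorList ν).map fun q => hermiteStep q.2 (y q.1)).prod 0 0 =
      ∏ j ∈ ν.support, Polynomial.aeval (y j) (Polynomial.hermite (ν j)) := by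
  have h : ((factorList ν).map fun q => hermiteStep q.2 (y q.1)).prod =
      (ν.support.toList.map fun j => hermiteBlock (ν j) (y j)).prod := by
    rw [factorList]
    induction ν.support.toList with
    | nil => rfl
    | cons j l ih =>
      rw [List.flatMap_cons, List.map_append, List.prod_append, ih, List.map_cons,
        List.prod_cons, hermiteBlock, List.map_map]
      rfl
  rw [h, prod_apply_zero_zero, List.map_map, ← Finset.prod_map_toList]
  · congr 1
    refine List.map_congr_left fun j _ => ?_
    exact hermiteBlock_apply_zero_zero _ _
  · intro A hA
    obtain ⟨j, -, rfl⟩ := List.mem_map.1 hA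
    exact hermiteBlock_apply_zero_one _ _

/-- The product of the normalizing constants `√(ν_j !)`. -/
noncomputable def hermiteScale (ν : ℕ →₀ ℕ) : ℝ := ∏ j ∈ ν.support, Real.sqrt ((ν j).factorial : ℝ)

theorem one_le_hermiteScale (ν : ℕ →₀ ℕ) : 1 ≤ hermiteScale ν :=
  Finset.one_le_prod fun j _ => by
    rw [Real.one_le_sqrt]
    exact_mod_cast Nat.one_le_iff_ne_zero.2 (Nat.factorial_ne_zero _)

theorem hermiteTensor_eq {ν : ℕ →₀ ℕ} {N : ℕ} (hN : ν.degree ≤ N) (y : ℕ → ℝ) :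
    hermiteTensor ν y =
      ((List.range N).map fun p => factorMatrix ν p y).prod 0 0 / hermiteScale ν := by
  rw [prod_factorMatrix hN, prod_factorList_apply, hermiteScale, ← Finset.prod_div_distrib]
  rfl

section

attribute [local instance] Matrix.linftyOpNormedRing

theorem norm_factorMatrix_le {ν : ℕ →₀ ℕ} (p : ℕ) {y : ℕ → ℝ} {s : ℝ} (hs : 0 ≤ s)
    (hy : ∀ j ∈ ν.support, |y j| ≤ s) : ‖factorMatrix ν p y‖ ≤ s + ν.degree + 1 := by
  have hd : (0 : ℝ) ≤ ν.degree := Nat.cast_nonneg _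
  refine Matrix.linftyOpNorm_le_of_sum_abs_le fun i => ?_
  unfold factorMatrix
  split_ifs with h
  · have hq := mem_factorList (List.getElem_mem h)
    have h1 := hy _ hq.1
    have h2 : (((factorList ν)[p]).2 : ℝ) + 1 ≤ ν.degree := by exact_mod_cast hq.2
    fin_cases i
    · simp [hermiteStep]
      linarith
    · simp [hermiteStep]
      linarith
  · have h1 : |(1 : Matrix (Fin 2) (Fin 2) ℝ) i 0| + |(1 : Matrix (Fin 2) (Fin 2) ℝ) i 1| = 1 := by
      fin_cases i <;> simp [Matrix.one_apply]
    linarith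

/-- Submultiplicativity of the norm over the transfer matrices; dividing by the normalization, which
is at least 1, only helps. -/
theorem abs_hermiteTensor_le {ν : ℕ →₀ ℕ} {y : ℕ → ℝ} {s : ℝ} (hs : 0 ≤ s)
    (hy : ∀ j ∈ ν.support, |y j| ≤ s) :
    |hermiteTensor ν y| ≤ (s + ν.degree + 1) ^ ν.degree := by
  have hb (n : ℕ) : ‖((List.range n).map fun p => factorMatrix ν p y).prod‖ ≤
      (s + ν.degree + 1) ^ n := by
    induction n with
    | zero =>
      simp only [List.range_zero, List.map_nil, List.prod_nil, pow_zero]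
      exact Matrix.linftyOpNorm_le_of_sum_abs_le fun i => by
        fin_cases i <;> simp [Matrix.one_apply]
    | succ n ih =>
      rw [List.prod_range_succ, pow_succ]
      exact (norm_mul_le _ _).trans (mul_le_mul ih (norm_factorMatrix_le n hs hy)
        (norm_nonneg _) (by positivity))
  have h1 := one_le_hermiteScale ν
  rw [hermiteTensor_eq le_rfl, abs_div, abs_of_nonneg (by linarith : 0 ≤ hermiteScale ν)]
  exact (div_le_self (abs_nonneg _) h1).trans
    ((Matrix.abs_le_linftyOpNorm _ _ _).trans (hb _))

end

/-! ### Gaussian tails -/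

instance isProbabilityMeasure_gaussianSeq : IsProbabilityMeasure gaussianSeq := by
  unfold gaussianSeq; infer_instance

theorem integrable_exp_mul_abs_gaussianReal (t : ℝ) :
    Integrable (fun x => Real.exp (t * |x|)) (gaussianReal 0 1) :=
  ((integrable_exp_mul_gaussianReal t).add (integrable_exp_mul_gaussianReal (-t))).mono'
    (by fun_prop) (.of_forall fun x => by
      rw [Real.norm_of_nonneg (Real.exp_pos _).le, Pi.add_apply]
      rcases abs_choice x with h | h <;> rw [h]
      · linarith [Real.exp_pos (-t * x)]
      · rw [show t * -x = -t * x by ring]; linarith [Real.exp_pos (t * x)])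

theorem integral_exp_mul_abs_gaussianReal_le (t : ℝ) :
    ∫ x, Real.exp (t * |x|) ∂(gaussianReal 0 1) ≤ 2 * Real.exp (t ^ 2 / 2) := by
  have h (s : ℝ) : ∫ x, Real.exp (s * x) ∂(gaussianReal 0 1) = Real.exp (s ^ 2 / 2) := by
    simpa [mgf] using congr_fun (mgf_fun_id_gaussianReal (μ := 0) (v := 1)) s
  calc ∫ x, Real.exp (t * |x|) ∂(gaussianReal 0 1)
      ≤ ∫ x, (Real.exp (t * x) + Real.exp (-t * x)) ∂(gaussianReal 0 1) := by
        refine integral_mono (integrable_exp_mul_abs_gaussianReal t)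
          ((integrable_exp_mul_gaussianReal t).add (integrable_exp_mul_gaussianReal (-t)))
          fun x => ?_
        rcases abs_choice x with h | h <;> simp only [h]
        · linarith [Real.exp_pos (-t * x)]
        · rw [show t * -x = -t * x by ring]; linarith [Real.exp_pos (t * x)]
    _ = 2 * Real.exp (t ^ 2 / 2) := by
        rw [integral_add (integrable_exp_mul_gaussianReal t)
          (integrable_exp_mul_gaussianReal (-t)), h, h, neg_sq]
        ring

/-- By independence the second moment is a product of `E exp(4 |y_j|) ≤ 2 e ^ 8 ≤ e ^ 10`; the
square root gives `e ^ 5` per coordinate. -/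
theorem eLpNorm_exp_two_mul_sum_abs_le (s : Finset ℕ) :
    eLpNorm (fun y : ℕ → ℝ => Real.exp (2 * ∑ j ∈ s, |y j|)) 2 gaussianSeq ≤
      ENNReal.ofReal (Real.exp (5 * s.card)) := by
  have hind : iIndepFun (fun (j : ℕ) (y : ℕ → ℝ) => |y j|) gaussianSeq :=
    iIndepFun_infinitePi (P := fun _ : ℕ => gaussianReal 0 1) (X := fun _ x => |x|)
      fun _ => by fun_prop
  have hmeas (j : ℕ) : Measurable fun y : ℕ → ℝ => |y j| := by fun_prop
  have hmap (j : ℕ) : gaussianSeq.map (fun y => y j) = gaussianReal 0 1 :=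
    Measure.infinitePi_map_eval _ j
  have hint1 (j : ℕ) : Integrable (fun y : ℕ → ℝ => Real.exp (4 * |y j|)) gaussianSeq := by
    have h := integrable_exp_mul_abs_gaussianReal 4
    rw [← hmap j] at h
    exact h.comp_measurable (measurable_pi_apply j)
  have hmgf (j : ℕ) : mgf (fun y : ℕ → ℝ => |y j|) gaussianSeq 4 ≤ Real.exp 10 := by
    have h := integral_exp_mul_abs_gaussianReal_le 4
    rw [← hmap j, integral_map (measurable_pi_apply j).aemeasurable (by fun_prop)] at h
    have h2 : (2 : ℝ) ≤ Real.exp 2 := by linarith [Real.add_one_le_exp 2]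
    calc _ ≤ 2 * Real.exp (4 ^ 2 / 2) := h
      _ ≤ Real.exp 2 * Real.exp (4 ^ 2 / 2) := by gcongr
      _ = Real.exp 10 := by rw [← Real.exp_add]; norm_num
  have hint := hind.integrable_exp_mul_sum hmeas (s := s) fun j _ => hint1 j
  have hle : ∫ y : ℕ → ℝ, Real.exp (4 * (∑ j ∈ s, fun y : ℕ → ℝ => |y j|) y) ∂gaussianSeq ≤
      Real.exp (5 * s.card) ^ 2 := by
    calc _ = ∏ j ∈ s, mgf (fun y : ℕ → ℝ => |y j|) gaussianSeq 4 := hind.mgf_sum hmeas s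
      _ ≤ ∏ j ∈ s, Real.exp 10 := Finset.prod_le_prod (fun j _ => mgf_nonneg) fun j _ => hmgf j
      _ = Real.exp (5 * s.card) ^ 2 := by
        rw [Finset.prod_const, ← Real.exp_nat_mul, ← Real.exp_nat_mul]
        congr 1
        push_cast
        ring
  have h2 := eLpNorm_nnreal_pow_eq_lintegral (μ := gaussianSeq) (p := 2)
    (f := fun y : ℕ → ℝ => Real.exp (2 * ∑ j ∈ s, |y j|)) two_ne_zero
  rw [← ENNReal.rpow_le_rpow_iff (z := (2 : NNReal)) (by norm_num)]
  refine h2.le.trans ?_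
  calc ∫⁻ y : ℕ → ℝ, ‖Real.exp (2 * ∑ j ∈ s, |y j|)‖ₑ ^ ((2 : NNReal) : ℝ) ∂gaussianSeq
      = ∫⁻ y : ℕ → ℝ, ENNReal.ofReal
          (Real.exp (4 * (∑ j ∈ s, fun y : ℕ → ℝ => |y j|) y)) ∂gaussianSeq := by
        refine lintegral_congr fun y => ?_
        rw [Real.enorm_of_nonneg (Real.exp_pos _).le,
          ENNReal.ofReal_rpow_of_nonneg (Real.exp_pos _).le (by norm_num), ← Real.exp_mul]
        simp only [Finset.sum_apply, NNReal.coe_ofNat]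
        congr 2
        ring
    _ = ENNReal.ofReal (∫ y : ℕ → ℝ,
          Real.exp (4 * (∑ j ∈ s, fun y : ℕ → ℝ => |y j|) y) ∂gaussianSeq) :=
        (ofReal_integral_eq_lintegral_ofReal hint
          (.of_forall fun y => (Real.exp_pos _).le)).symm
    _ ≤ ENNReal.ofReal (Real.exp (5 * s.card) ^ 2) := ENNReal.ofReal_le_ofReal hle
    _ = _ := by
        rw [ENNReal.ofReal_rpow_of_nonneg (Real.exp_pos _).le (by norm_num), NNReal.coe_ofNat,
          Real.rpow_two]

theorem eLpNorm_le_of_abs_le_exp {F : (ℕ → ℝ) → ℝ} {s : Finset ℕ} {e A : ℝ} (he : 0 ≤ e)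
    (hA : 0 ≤ A) (h : ∀ y, |F y| ≤ e + A * Real.exp (2 * ∑ j ∈ s, |y j|)) :
    eLpNorm F 2 gaussianSeq ≤ ENNReal.ofReal (e + A * Real.exp (5 * s.card)) := by
  refine (eLpNorm_mono_real (g := (fun _ => e) +
    A • fun y : ℕ → ℝ => Real.exp (2 * ∑ j ∈ s, |y j|)) fun y => by simpa using h y).trans ?_
  refine (eLpNorm_add_le (by fun_prop) (by fun_prop) (by norm_num)).trans ?_
  rw [ENNReal.ofReal_add he (by positivity), ENNReal.ofReal_mul hA]
  refine add_le_add ?_ ?_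
  · rw [eLpNorm_const _ (by norm_num) (NeZero.ne _), measure_univ, ENNReal.one_rpow, mul_one,
      Real.enorm_of_nonneg he]
  · rw [eLpNorm_const_smul, Real.enorm_of_nonneg hA]
    gcongr
    exact eLpNorm_exp_two_mul_sum_abs_le s

/-! ### Truncation -/

/-- The truncation of `x` to the interval `[-M, M]`. -/
noncomputable def clip (M x : ℝ) : ℝ := M - relu (2 * M - relu (x + M))

theorem clip_of_abs_le {M x : ℝ} (h : |x| ≤ M) : clip M x = x := by
  obtain ⟨h1, h2⟩ := abs_le.1 h
  rw [clip, relu, relu, max_eq_left (by linarith : 0 ≤ x + M), max_eq_left (by linarith)]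
  ring

theorem abs_clip_le {M : ℝ} (hM : 0 ≤ M) (x : ℝ) : |clip M x| ≤ M := by
  unfold clip relu
  rw [abs_le]
  have h1 : 0 ≤ max (x + M) 0 := le_max_right _ _
  constructor
  · have : max (2 * M - max (x + M) 0) 0 ≤ 2 * M := max_le (by linarith) (by linarith)
    linarith
  · linarith [le_max_right (2 * M - max (x + M) 0) 0]

theorem abs_clip_le_abs {M : ℝ} (hM : 0 ≤ M) (x : ℝ) : |clip M x| ≤ |x| := by
  rcases le_total |x| M with h | h
  · rw [clip_of_abs_le h]
  · exact (abs_clip_le hM x).trans h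

theorem hermiteTensor_congr {ν : ℕ →₀ ℕ} {y z : ℕ → ℝ} (h : ∀ j ∈ ν.support, y j = z j) :
    hermiteTensor ν y = hermiteTensor ν z :=
  Finset.prod_congr rfl fun j hj => by rw [h j hj]

/-- If no relevant coordinate is clipped the difference is 0. Otherwise `s = ∑ |y_j| ≥ M`, both
terms are at most `m! exp(s + m + 1)`, and `exp s ≤ exp(2 s - M)`. -/
theorem abs_hermiteTensor_sub_clip_le {ν : ℕ →₀ ℕ} {m : ℕ} (hm : ν.degree ≤ m) {M : ℝ}
    (hM : 0 ≤ M) (y : ℕ → ℝ) :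
    |hermiteTensor ν y - hermiteTensor ν fun j => clip M (y j)| ≤
      2 * m.factorial * Real.exp (m + 1 - M) * Real.exp (2 * ∑ j ∈ ν.support, |y j|) := by
  set s := ∑ j ∈ ν.support, |y j| with hs
  have hs0 : 0 ≤ s := Finset.sum_nonneg fun _ _ => abs_nonneg _
  have hle : ∀ j ∈ ν.support, |y j| ≤ s := fun j hj =>
    Finset.single_le_sum (f := fun j => |y j|) (fun _ _ => abs_nonneg _) hj
  by_cases h : ∀ j ∈ ν.support, |y j| ≤ M
  · rw [hermiteTensor_congr (z := fun j => clip M (y j)) fun j hj => (clip_of_abs_le (h j hj)).symm,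
      sub_self, abs_zero]
    positivity
  push Not at h
  obtain ⟨j, hj, hjM⟩ := h
  have hsM : M ≤ s := hjM.le.trans (hle j hj)
  have hm' : (ν.degree : ℝ) ≤ m := by exact_mod_cast hm
  have hd : (0 : ℝ) ≤ ν.degree := Nat.cast_nonneg _
  have hbd : (s + ν.degree + 1) ^ ν.degree ≤ m.factorial * Real.exp (s + m + 1) := by
    calc (s + ν.degree + 1) ^ ν.degree ≤ (s + m + 1) ^ ν.degree := by gcongr
      _ ≤ (s + m + 1) ^ m := pow_le_pow_right₀ (by linarith) hm
      _ ≤ m.factorial * Real.exp (s + m + 1) := by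
        have := Real.pow_div_factorial_le_exp (s + m + 1) (by positivity) m
        rwa [div_le_iff₀ (by positivity), mul_comm] at this
  have h1 := (abs_hermiteTensor_le hs0 hle).trans hbd
  have h2 := (abs_hermiteTensor_le (y := fun j => clip M (y j)) hs0
    fun j hj => (abs_clip_le_abs hM _).trans (hle j hj)).trans hbd
  calc _ ≤ 2 * (m.factorial * Real.exp (s + m + 1)) := by
        refine (abs_sub _ _).trans ?_
        linarith
    _ ≤ 2 * (m.factorial * Real.exp (m + 1 - M + 2 * s)) := by
        gcongr 2 * (_ * Real.exp ?_)
        linarith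
    _ = _ := by rw [Real.exp_add]; ring

/-! ### The network -/

theorem isSparseAffine_hermiteStep {ι : Type} [Fintype ι] {R : ℕ} {g : (ι → ℝ) → ℝ}
    (hg : IsSparseAffine R g) (n : ℕ) (a b : Fin 2) :
    IsSparseAffine R (fun x => hermiteStep n (g x) a b) := by
  fin_cases a <;> fin_cases b
  · exact hg
  all_goals exact (IsSparseAffine.const _).mono (Nat.zero_le _)

theorem isSparseAffine_factorMatrix {ι : Type} [Fintype ι] {R : ℕ} {y : (ι → ℝ) → ℕ → ℝ}
    (hy : ∀ j, IsSparseAffine R (fun x => y x j)) (ν : ℕ →₀ ℕ) (p : ℕ) (a b : Fin 2) :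
    IsSparseAffine R (fun x => factorMatrix ν p (y x) a b) := by
  unfold factorMatrix
  split_ifs
  · exact isSparseAffine_hermiteStep (hy _) _ a b
  · exact (IsSparseAffine.const _).mono (Nat.zero_le _)

/-- The coordinates `y j`, `j ∈ J`, clipped to `[-M, M]`, and `M` in the other coordinates. -/
noncomputable def clipOn (J : Finset ℕ) (M : ℝ) (y : ℕ → ℝ) (j : ℕ) : ℝ :=
  if j ∈ J then clip M (y j) else M

/-- The network output for the multi-index `ν`. -/
noncomputable def approxHermite (J : Finset ℕ) (M Q : ℝ) (K S : ℕ) (ν : ℕ →₀ ℕ)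
    (y : ℕ → ℝ) : ℝ :=
  Q ^ 2 ^ K / hermiteScale ν *
    approxProd S K (fun p => Q⁻¹ • factorMatrix ν p (clipOn J M y)) 0 0

/-- Two layers clip the inputs (`16 |J|` in size), one forms the scaled transfer matrices, whose
entries each read at most one coordinate, and the tree follows. The output map only rescales, and is
counted twice as `4 |Λ|`. -/
theorem exists_neuralNet_approxHermite (Λ : Finset (ℕ →₀ ℕ)) (J : Finset ℕ) (M Q : ℝ)
    (K S : ℕ) :
    ∃ Φ : NeuralNet {ν // ν ∈ Λ} {j // j ∈ J},
      (∀ (y : ℕ → ℝ) (ν : {ν // ν ∈ Λ}),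
        Φ.eval relu (fun j => y j.1) ν = approxHermite J M Q K S ν.1 y) ∧
      Φ.depth = K * (S + 2) + 3 ∧
      Φ.size ≤ K * ((S + 2) * (640 * (Λ.card * 2 ^ K))) + 32 * (Λ.card * 2 ^ K) +
        4 * Λ.card + 16 * J.card := by
  classical
  let I := {ν // ν ∈ Λ}
  let X := {j // j ∈ J}
  -- The last affine part `M - ·` of the clipping needs no layer of its own: it is merged into the
  -- transfer matrices.
  let y' : (X → ℝ) → ℕ → ℝ := fun z j => if h : j ∈ J then M - z ⟨j, h⟩ else M
  have hy' : ∀ j, IsSparseAffine 1 (fun z => y' z j) := fun j => by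
    by_cases h : j ∈ J
    · refine (((IsSparseAffine.const M).add ((IsSparseAffine.coord (⟨j, h⟩ : X)).const_mul
        (-1))).mono (by norm_num)).congr fun z => ?_
      simp only [y', dif_pos h]
      ring
    · exact ((IsSparseAffine.const M).mono (by norm_num)).congr fun z => by simp only [y', dif_neg h]
  let f1 : (X → ℝ) → X → ℝ := fun x j => relu (x j + M)
  let f2 : (X → ℝ) → X → ℝ := fun x j => relu (2 * M - x j)
  let f3 : (X → ℝ) → I × Fin (2 ^ K) × Fin 2 × Fin 2 → ℝ := fun z q =>
    Q⁻¹ * factorMatrix q.1.1 q.2.1 (y' z) q.2.2.1 q.2.2.2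
  let g : (I × Fin (2 ^ 0) × Fin 2 × Fin 2 → ℝ) → I → ℝ := fun x ν =>
    Q ^ 2 ^ K / hermiteScale ν.1 * x (ν, ⟨0, by norm_num⟩, 0, 0)
  have hf1 : IsReluStep 1 f1 := fun j => ⟨fun x => x j + M,
    ((IsSparseAffine.coord j).add (.const M)).mono (by norm_num), 1, 0, fun x => by simp [f1]⟩
  have hf2 : IsReluStep 1 f2 := fun j => ⟨fun x => 2 * M + (-1) * x j,
    ((IsSparseAffine.const (2 * M)).add ((IsSparseAffine.coord j).const_mul (-1))).mono
      (by norm_num), 1, 0, fun x => by simp [f2, sub_eq_add_neg]⟩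
  have hf3 : IsReluStep 1 f3 := .of_affine fun q =>
    (isSparseAffine_factorMatrix hy' _ _ _ _).const_mul _
  have hg : IsRealized 0 (2 * (Fintype.card I * (1 + 1))) g := isRealized_affine fun ν =>
    (IsSparseAffine.coord _).const_mul _
  have hchain := (isReluChain_approxProd (I := I) S K).comp
    ((IsReluChain.of_step hf3).comp ((IsReluChain.of_step hf2).comp (.of_step hf1)))
  obtain ⟨Φ, he, hd, hs⟩ := hchain _ _ _ _ hg
  refine ⟨Φ, fun y ν => ?_, ?_, ?_⟩
  · rw [he]
    simp only [g, approxHermite]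
    congr 1
    refine congr_fun (congr_fun (approxProd_congr S K fun p hp => ?_) _) _
    have hclip : y' (f2 (f1 fun j => y j.1)) = clipOn J M y := by
      ext j
      by_cases h : j ∈ J <;> simp [y', f1, f2, clipOn, clip, h]
    rw [matrixSeq, dif_pos hp]
    ext a b
    exact congrArg (fun z => Q⁻¹ * factorMatrix ν.1 p z a b) hclip
  · rw [hd]; ring
  · simp only [I, X, Fintype.card_prod, Fintype.card_fin, Fintype.card_coe] at hs
    refine le_trans (Nat.le_add_right _ _) (hs.trans (le_of_eq ?_))
    ring

section

attribute [local instance] Matrix.linftyOpNormedRing Matrix.linftyOpNormedSpace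

/-- After division by `Q` the factors have norm at most 1 and enter the tree exactly, so the tree
error holds with `e = 0`; rescaling multiplies it by at most `Q ^ 2 ^ K`. -/
theorem abs_hermiteTensor_sub_approxHermite_le {ν : ℕ →₀ ℕ} {J : Finset ℕ} {m K S : ℕ}
    {M Q e : ℝ} (hm : ν.degree ≤ m) (hK : m ≤ 2 ^ K) (hM : 0 ≤ M) (hQ : M + m + 1 ≤ Q)
    (he : Q ^ 2 ^ K * (4 ^ K * (32 * (1 / 4) ^ S)) ≤ e) (he1 : e ≤ 1) (y : ℕ → ℝ) :
    |hermiteTensor ν (clipOn J M y) - approxHermite J M Q K S ν y| ≤ e := by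
  have hm' : (ν.degree : ℝ) ≤ m := by exact_mod_cast hm
  have hm0 : (0 : ℝ) ≤ m := Nat.cast_nonneg _
  have hQ1 : 1 ≤ Q := by linarith
  have hQ0 : 0 < Q := by linarith
  have hc : ∀ j, |clipOn J M y j| ≤ M := fun j => by
    unfold clipOn
    split_ifs
    · exact abs_clip_le hM _
    · exact (abs_of_nonneg hM).le
  have hQN : 1 ≤ Q ^ 2 ^ K := one_le_pow₀ hQ1
  have hδ : (0 : ℝ) ≤ 4 ^ K * (32 * (1 / 4) ^ S) := by positivity
  set G : ℕ → Matrix (Fin 2) (Fin 2) ℝ := fun p => Q⁻¹ • factorMatrix ν p (clipOn J M y) with hG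
  have hnorm : ∀ p, ‖G p‖ ≤ 1 := fun p => by
    have h := norm_factorMatrix_le (ν := ν) p hM fun j _ => hc j
    calc ‖G p‖ ≤ ‖Q⁻¹‖ * ‖factorMatrix ν p (clipOn J M y)‖ := norm_smul_le _ _
      _ ≤ Q⁻¹ * Q := by
        rw [Real.norm_of_nonneg (by positivity)]
        gcongr
        linarith
      _ = 1 := inv_mul_cancel₀ hQ0.ne'
  have h1 := norm_approxProd_sub_le S K le_rfl hnorm (f := G) (fun p => by simp)
    (by rw [zero_add]; nlinarith)
  rw [zero_add] at h1
  have hprod (n : ℕ) : ((List.range n).map G).prod =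
      (Q⁻¹) ^ n • ((List.range n).map fun p => factorMatrix ν p (clipOn J M y)).prod := by
    induction n with
    | zero => simp
    | succ n ih =>
      rw [List.prod_range_succ, List.prod_range_succ, ih, hG, smul_mul_smul_comm, pow_succ]
  have h2 := Matrix.abs_le_linftyOpNorm (approxProd S K G - ((List.range (2 ^ K)).map G).prod) 0 0
  have hs := one_le_hermiteScale ν
  have heq : hermiteTensor ν (clipOn J M y) - approxHermite J M Q K S ν y =
      -(Q ^ 2 ^ K / hermiteScale ν *
        (approxProd S K G - ((List.range (2 ^ K)).map G).prod) 0 0) := by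
    rw [hermiteTensor_eq (hm.trans hK), approxHermite, ← hG, Matrix.sub_apply, hprod,
      Matrix.smul_apply, smul_eq_mul, inv_pow]
    have : Q ^ 2 ^ K ≠ 0 := by positivity
    field_simp
    ring
  rw [heq, abs_neg, abs_mul, abs_of_nonneg (by positivity)]
  calc _ ≤ Q ^ 2 ^ K * (4 ^ K * (32 * (1 / 4) ^ S)) :=
        mul_le_mul (div_le_self (by positivity) hs) (h2.trans h1) (abs_nonneg _) (by positivity)
    _ ≤ e := he

end

/-! ### Choice of the parameters -/

/-- With `m! ≤ exp(m ^ 2)` and `4 ≤ e ^ 2`, it remains to see `3 + 6 m + m ^ 2 ≤ 10 m ^ 2`, which is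
sharp at `m = 1`. -/
theorem truncation_error_le {m : ℕ} (hm : 1 ≤ m) (l : ℝ) :
    2 * m.factorial * Real.exp (m + 1 - (10 * m ^ 2 + l)) * Real.exp (5 * m) ≤
      Real.exp (-l) / 2 := by
  have hm' : (1 : ℝ) ≤ m := by exact_mod_cast hm
  have h1 : (m.factorial : ℝ) ≤ Real.exp (m ^ 2) := by
    calc (m.factorial : ℝ) ≤ (m : ℝ) ^ m := by exact_mod_cast Nat.factorial_le_pow m
      _ ≤ Real.exp m ^ m := by
        gcongr
        linarith [Real.add_one_le_exp (m : ℝ)]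
      _ = Real.exp (m ^ 2) := by rw [← Real.exp_nat_mul, sq]
  have h2 : (4 : ℝ) ≤ Real.exp 2 := by
    linarith [Real.quadratic_le_exp_of_nonneg (zero_le_two (α := ℝ))]
  have h3 : 4 * m.factorial * Real.exp (m + 1 - (10 * m ^ 2 + l)) * Real.exp (5 * m) ≤
      Real.exp (-l) := by
    calc _ ≤ Real.exp 2 * Real.exp (m ^ 2) * Real.exp (m + 1 - (10 * m ^ 2 + l)) *
          Real.exp (5 * m) := by gcongr
      _ ≤ Real.exp (-l) := by
        rw [← Real.exp_add, ← Real.exp_add, ← Real.exp_add, Real.exp_le_exp]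
        nlinarith
  linarith

theorem half_le_log_one_add {x : ℝ} (hx : 1 ≤ x) : 1 / 2 ≤ Real.log (1 + x) := by
  have := Real.log_two_gt_d9
  have := Real.log_le_log two_pos (by linarith : 2 ≤ 1 + x)
  linarith

theorem two_pow_clog_le {m : ℕ} (hm : 1 ≤ m) : 2 ^ Nat.clog 2 m ≤ 2 * m := by
  rcases Nat.lt_or_ge 1 m with h | h
  · have h1 : Nat.clog 2 m ≠ 0 := (Nat.clog_pos one_lt_two h).ne'
    have h2 := Nat.pow_pred_clog_lt_self one_lt_two h
    obtain ⟨k, hk⟩ := Nat.exists_eq_succ_of_ne_zero h1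
    rw [hk] at h2 ⊢
    rw [Nat.pred_succ] at h2
    rw [pow_succ]
    omega
  · obtain rfl : m = 1 := le_antisymm h hm
    simp

theorem clog_two_le_log {m : ℕ} (hm : 1 ≤ m) :
    (Nat.clog 2 m : ℝ) ≤ 4 * Real.log (1 + m) := by
  have h1 : ((2 : ℝ)) ^ Nat.clog 2 m ≤ (1 + m) ^ 2 := by
    have : ((2 : ℝ)) ^ Nat.clog 2 m ≤ 2 * m := by exact_mod_cast two_pow_clog_le hm
    nlinarith [sq_nonneg (m : ℝ)]
  have h2 := Real.log_le_log (by positivity) h1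
  rw [Real.log_pow, Real.log_pow] at h2
  push_cast at h2
  have := Real.log_two_gt_d9
  have h0 : (0 : ℝ) ≤ Nat.clog 2 m := Nat.cast_nonneg _
  nlinarith

/-- With `t = log(1 + m)`, the power of `Q` is at most `exp(16 m t l)` and `64 * 4 ^ K` at most
`exp(10 m t l)`. The constant `28 = 16 + 10 + 2` leaves `exp(-2 m t l) ≤ exp(-l)`, because `t ≥
1/2`. -/
theorem network_error_le {m S : ℕ} (hm : 1 ≤ m) {l : ℝ} (hl : 1 ≤ l)
    (hS : 28 * m * Real.log (1 + m) * l ≤ S) :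
    (10 * (m : ℝ) ^ 2 + l + m + 1) ^ 2 ^ Nat.clog 2 m *
      (4 ^ Nat.clog 2 m * (32 * (1 / 4) ^ S)) ≤ Real.exp (-l) / 2 := by
  have hm' : (1 : ℝ) ≤ m := by exact_mod_cast hm
  set t := Real.log (1 + m) with ht
  have ht2 : 1 / 2 ≤ t := half_le_log_one_add hm'
  have htl : t ≤ t * l := le_mul_of_one_le_right (by linarith) hl
  have hl1 : l ≤ 2 * (t * l) := by nlinarith
  have hexp : Real.exp t = 1 + m := Real.exp_log (by positivity)
  have hQ : 10 * (m : ℝ) ^ 2 + l + m + 1 ≤ Real.exp (8 * (t * l)) := by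
    calc 10 * (m : ℝ) ^ 2 + l + m + 1 ≤ (2 : ℝ) ^ 4 * m ^ 2 * (l + 1) := by
          have h1 : (m : ℝ) ≤ m ^ 2 := le_self_pow₀ hm' two_ne_zero
          have h2 : 1 * l ≤ m ^ 2 * l := by gcongr; linarith
          linarith
      _ ≤ (1 + m) ^ 4 * (1 + m) ^ 2 * Real.exp l := by
        gcongr
        · linarith
        · linarith
        · exact Real.add_one_le_exp l
      _ = Real.exp (6 * t + l) := by
        rw [← pow_add, ← hexp, ← Real.exp_nat_mul, ← Real.exp_add]; norm_num
      _ ≤ Real.exp (8 * (t * l)) := Real.exp_le_exp.2 (by linarith)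
  have hN : (2 : ℝ) ^ Nat.clog 2 m ≤ 2 * m := by exact_mod_cast two_pow_clog_le hm
  have hQN : (10 * (m : ℝ) ^ 2 + l + m + 1) ^ 2 ^ Nat.clog 2 m ≤
      Real.exp (16 * (m * (t * l))) := by
    calc _ ≤ Real.exp (8 * (t * l)) ^ 2 ^ Nat.clog 2 m := by gcongr
      _ = Real.exp (2 ^ Nat.clog 2 m * (8 * (t * l))) := by
        rw [← Real.exp_nat_mul]; push_cast; rfl
      _ ≤ Real.exp (16 * (m * (t * l))) := by
        rw [Real.exp_le_exp]
        calc _ ≤ 2 * m * (8 * (t * l)) := by gcongr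
          _ = _ := by ring
  have h4 : 64 * (4 : ℝ) ^ Nat.clog 2 m ≤ Real.exp (10 * (m * (t * l))) := by
    calc 64 * (4 : ℝ) ^ Nat.clog 2 m = 64 * (2 ^ Nat.clog 2 m) ^ 2 := by
          rw [← pow_mul, mul_comm _ 2, pow_mul]; norm_num
      _ ≤ 64 * (2 * m) ^ 2 := by gcongr
      _ = 2 ^ 8 * (m : ℝ) ^ 2 := by ring
      _ ≤ (1 + m) ^ 8 * (1 + m) ^ 2 := by gcongr <;> linarith
      _ = Real.exp (10 * t) := by rw [← pow_add, ← hexp, ← Real.exp_nat_mul]; norm_num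
      _ ≤ Real.exp (10 * (m * (t * l))) := Real.exp_le_exp.2 (by nlinarith)
  have hS4 : (1 / 4 : ℝ) ^ S ≤ Real.exp (-(28 * (m * (t * l)))) := by
    have h : (1 / 4 : ℝ) ≤ Real.exp (-1) := by
      rw [Real.exp_neg, one_div]
      exact inv_anti₀ (Real.exp_pos _) (by linarith [Real.exp_one_lt_d9])
    calc (1 / 4 : ℝ) ^ S ≤ Real.exp (-1) ^ S := by gcongr
      _ = Real.exp (-S) := by rw [← Real.exp_nat_mul]; ring_nf
      _ ≤ _ := Real.exp_le_exp.2 (by linarith)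
  have key : (10 * (m : ℝ) ^ 2 + l + m + 1) ^ 2 ^ Nat.clog 2 m *
      ((64 * (4 : ℝ) ^ Nat.clog 2 m) * (1 / 4) ^ S) ≤ Real.exp (-l) := by
    calc _ ≤ Real.exp (16 * (m * (t * l))) *
          (Real.exp (10 * (m * (t * l))) * Real.exp (-(28 * (m * (t * l))))) := by gcongr
      _ ≤ Real.exp (-l) := by
        rw [← Real.exp_add, ← Real.exp_add, Real.exp_le_exp]
        nlinarith
  linarith

theorem depth_bound {m S : ℕ} (hm : 1 ≤ m) {l : ℝ} (hl : 1 ≤ l)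
    (hS : (S : ℝ) ≤ 28 * m * Real.log (1 + m) * l + 1) :
    (Nat.clog 2 m : ℝ) * (S + 2) ≤ 136 * (m * Real.log (1 + m) ^ 2 * l) := by
  have hm' : (1 : ℝ) ≤ m := by exact_mod_cast hm
  have ht := half_le_log_one_add hm'
  have hK := clog_two_le_log hm
  set t := Real.log (1 + m)
  have h1 : 1 / 2 ≤ m * t * l := by
    calc (1 : ℝ) / 2 ≤ t := ht
      _ = 1 * t * 1 := by ring
      _ ≤ m * t * l := by gcongr
  -- `S + 2 ≤ 28 X + 3 ≤ 34 X` for `X = m t l ≥ 1/2`.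
  calc (Nat.clog 2 m : ℝ) * (S + 2) ≤ 4 * t * (34 * (m * t * l)) := by
        gcongr
        linarith
    _ = _ := by ring

theorem card_support_le_degree (ν : ℕ →₀ ℕ) : ν.support.card ≤ ν.degree := by
  rw [Finsupp.degree_apply, Finset.card_eq_sum_ones]
  exact Finset.sum_le_sum fun j hj => Nat.one_le_iff_ne_zero.2 (Finsupp.mem_support_iff.1 hj)

/-- Clipping and network arithmetic each contribute at most `exp(-l) / 2`. -/
theorem eLpNorm_hermiteTensor_sub_approxHermite_le {ν : ℕ →₀ ℕ} {J : Finset ℕ} {m S : ℕ} (hm : 1 ≤ m) (hν : ν.degree ≤ m)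
    (hJ : ν.support ⊆ J) {l : ℝ} (hl : 1 ≤ l) (hS : 28 * m * Real.log (1 + m) * l ≤ S) :
    eLpNorm (fun y : ℕ → ℝ => hermiteTensor ν y -
      approxHermite J (10 * m ^ 2 + l) (10 * m ^ 2 + l + m + 1) (Nat.clog 2 m) S ν y)
      2 gaussianSeq ≤ ENNReal.ofReal (Real.exp (-l)) := by
  have hM : 0 ≤ 10 * (m : ℝ) ^ 2 + l := by positivity
  have hl1 : Real.exp (-l) ≤ 1 := Real.exp_le_one_iff.2 (by linarith)
  refine (eLpNorm_le_of_abs_le_exp (s := ν.support) (e := Real.exp (-l) / 2)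
    (A := 2 * m.factorial * Real.exp (m + 1 - (10 * m ^ 2 + l))) (by positivity) (by positivity)
    fun y => ?_).trans (ENNReal.ofReal_le_ofReal ?_)
  · have h1 := abs_hermiteTensor_sub_clip_le hν hM y
    have h2 := abs_hermiteTensor_sub_approxHermite_le (J := J) hν
      (Nat.le_pow_clog one_lt_two m) hM le_rfl (network_error_le hm hl hS) (by linarith) y
    have h3 : hermiteTensor ν (clipOn J (10 * m ^ 2 + l) y) =
        hermiteTensor ν fun j => clip (10 * m ^ 2 + l) (y j) :=
      hermiteTensor_congr fun j hj => if_pos (hJ hj)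
    rw [h3] at h2
    refine (abs_sub_le _ _ _).trans ((add_le_add h1 h2).trans_eq (add_comm _ _))
  · have hcard : (ν.support.card : ℝ) ≤ m := by
      exact_mod_cast (card_support_le_degree ν).trans hν
    have h1 := truncation_error_le hm l
    have h2 : 2 * m.factorial * Real.exp (m + 1 - (10 * m ^ 2 + l)) *
        Real.exp (5 * ν.support.card) ≤ Real.exp (-l) / 2 := le_trans (by gcongr) h1
    linarith

/-! ### Assembly of the bounds -/

theorem card_indexSupport_le (Λ : Finset (ℕ →₀ ℕ)) :
    (indexSupport Λ).card ≤ Λ.card * maxOrder Λ :=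
  Finset.card_biUnion_le_card_mul _ _ _ fun ν hν =>
    (card_support_le_degree ν).trans (Finset.le_sup (f := fun ν => Finsupp.degree ν) hν)

theorem theorem3p5 :
    ∃ C : ℝ, 0 < C ∧
      ∀ Λ : Finset (ℕ →₀ ℕ), IsLowerSet (Λ : Set (ℕ →₀ ℕ)) → Λ ≠ {0} →
        ∀ ε : ℝ, 0 < ε → ε < Real.exp (-1) →
          ∃ Φ : NeuralNet {ν // ν ∈ Λ} {j // j ∈ indexSupport Λ},
            (∀ ν : {ν // ν ∈ Λ},
              eLpNorm (fun y : ℕ → ℝ => hermiteTensor ν.1 y - Φ.eval relu (fun j => y j.1) ν)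
                2 gaussianSeq ≤ ENNReal.ofReal ε) ∧
            (Φ.size : ℝ) ≤ C * (Λ.card : ℝ) * (maxOrder Λ : ℝ) ^ 3 *
              Real.log (1 + (maxOrder Λ : ℝ)) * (effectiveDim Λ : ℝ) ^ 2 * Real.log (ε⁻¹) ∧
            (Φ.depth : ℝ) ≤ C * (maxOrder Λ : ℝ) * Real.log (1 + (maxOrder Λ : ℝ)) ^ 2 *
              (effectiveDim Λ : ℝ) * Real.log (1 + (effectiveDim Λ : ℝ)) * Real.log (ε⁻¹) := by
  -- The size estimate needs `174080 + 168`, where `174080 = 136 * 640 * 2`; the depth estimate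
  -- needs only 296.
  refine ⟨200000, by norm_num, fun Λ _ hΛ ε hε hε1 => ?_⟩
  rcases Λ.eq_empty_or_nonempty with rfl | hne
  · refine ⟨.affine 0 0, fun ν => absurd ν.2 (Finset.notMem_empty _), ?_, ?_⟩
    · simp [NeuralNet.size, NeuralNet.layerSize]
    · simp [NeuralNet.depth, maxOrder]
  -- A nonzero index forces `m, d ≥ 1`. For `{0}` the size bound would be 0, although the constant 1
  -- requires a bias.
  obtain ⟨μ, hμ, hμ0⟩ : ∃ μ ∈ Λ, μ ≠ 0 := by
    by_contra! h
    exact hΛ (Finset.eq_singleton_iff_nonempty_unique_mem.2 ⟨hne, h⟩)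
  have hμ1 : 1 ≤ μ.support.card := Finset.card_pos.2 (Finsupp.support_nonempty_iff.2 hμ0)
  have hdeg : ∀ ν ∈ Λ, ν.degree ≤ maxOrder Λ := fun ν hν =>
    Finset.le_sup (f := fun ν => Finsupp.degree ν) hν
  have hm : 1 ≤ maxOrder Λ := hμ1.trans ((card_support_le_degree μ).trans (hdeg μ hμ))
  have hd : 1 ≤ effectiveDim Λ :=
    hμ1.trans (Finset.le_sup (f := fun ν : ℕ →₀ ℕ => ν.support.card) hμ)
  have hJ := card_indexSupport_le Λ
  set m := maxOrder Λ
  set d := effectiveDim Λ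
  set l := Real.log ε⁻¹ with hl
  have hεl : Real.exp (-l) = ε := by rw [hl, Real.log_inv, neg_neg, Real.exp_log hε]
  have hl1 : 1 ≤ l := by
    rw [← hεl, Real.exp_lt_exp] at hε1
    linarith
  have hm' : (1 : ℝ) ≤ m := by exact_mod_cast hm
  have hd' : (1 : ℝ) ≤ d := by exact_mod_cast hd
  have ht := half_le_log_one_add hm'
  have ht' := half_le_log_one_add hd'
  have htm : Real.log (1 + m) ≤ m := by
    linarith [Real.log_le_sub_one_of_pos (by positivity : (0 : ℝ) < 1 + m)]
  set S := ⌈28 * m * Real.log (1 + m) * l⌉₊ with hS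
  have hS1 : 28 * m * Real.log (1 + m) * l ≤ S := Nat.le_ceil _
  have hS2 : (S : ℝ) ≤ 28 * m * Real.log (1 + m) * l + 1 :=
    (Nat.ceil_lt_add_one (by positivity)).le
  have hdepth := depth_bound hm hl1 hS2
  set t := Real.log (1 + m)
  set td := Real.log (1 + d)
  set K := Nat.clog 2 m
  have hN : (2 : ℝ) ^ K ≤ 2 * m := by exact_mod_cast two_pow_clog_le hm
  obtain ⟨Φ, heval, hΦd, hΦs⟩ := exists_neuralNet_approxHermite Λ (indexSupport Λ)
    (10 * m ^ 2 + l) (10 * m ^ 2 + l + m + 1) K S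
  have htl : 1 / 2 ≤ t * l := ht.trans (le_mul_of_one_le_right (by linarith) hl1)
  refine ⟨Φ, fun ν => ?_, ?_, ?_⟩
  · simp only [heval]
    rw [← hεl]
    exact eLpNorm_hermiteTensor_sub_approxHermite_le hm (hdeg _ ν.2) (Finset.subset_biUnion_of_mem Finsupp.support ν.2) hl1 hS1
  · have hJ' : ((indexSupport Λ).card : ℝ) ≤ Λ.card * m := by exact_mod_cast hJ
    have h1 : (Φ.size : ℝ) ≤ K * ((S + 2) * (640 * (Λ.card * 2 ^ K))) + 32 * (Λ.card * 2 ^ K) +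
        4 * Λ.card + 16 * (indexSupport Λ).card := by exact_mod_cast hΦs
    have hc : (0 : ℝ) ≤ Λ.card := Nat.cast_nonneg _
    -- One of the two logarithms is given up through `t ≤ m`; with the width `2 ^ K ≤ 2 m` this
    -- yields `m ^ 3 log(1 + m)`.
    have h2 : (K : ℝ) * (S + 2) ≤ 136 * (m ^ 2 * (t * l)) := by
      calc (K : ℝ) * (S + 2) ≤ 136 * (m * t ^ 2 * l) := hdepth
        _ = 136 * (m * t * (t * l)) := by ring
        _ ≤ 136 * (m * m * (t * l)) := by gcongr
        _ = _ := by ring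
    have h3 : (m : ℝ) ≤ 2 * (m ^ 3 * (t * l)) := by
      calc (m : ℝ) ≤ m ^ 3 := le_self_pow₀ hm' (by norm_num)
        _ = 2 * (m ^ 3 * (1 / 2)) := by ring
        _ ≤ 2 * (m ^ 3 * (t * l)) := by gcongr
    calc (Φ.size : ℝ) ≤ (K * (S + 2)) * (640 * (Λ.card * 2 ^ K)) + 32 * (Λ.card * 2 ^ K) +
          4 * Λ.card + 16 * (indexSupport Λ).card := by linarith
      _ ≤ (136 * (m ^ 2 * (t * l))) * (640 * (Λ.card * (2 * m))) + 32 * (Λ.card * (2 * m)) +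
          4 * (Λ.card * m) + 16 * (Λ.card * m) := by
        gcongr
        exact le_mul_of_one_le_right hc hm'
      _ = 174080 * (Λ.card * (m ^ 3 * (t * l))) + 84 * (Λ.card * m) := by ring
      _ ≤ 174080 * (Λ.card * (m ^ 3 * (t * l))) + 84 * (Λ.card * (2 * (m ^ 3 * (t * l)))) := by
        gcongr
      _ ≤ 200000 * (Λ.card * (m ^ 3 * (t * l))) := by
        have : 0 ≤ Λ.card * ((m : ℝ) ^ 3 * (t * l)) := by positivity
        linarith
      _ ≤ 200000 * (Λ.card * (m ^ 3 * (t * l))) * d ^ 2 :=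
        le_mul_of_one_le_right (by positivity) (one_le_pow₀ hd')
      _ = _ := by ring
  · have h1 : (Φ.depth : ℝ) = K * (S + 2) + 3 := by rw [hΦd]; push_cast; ring
    have h2 : 1 / 4 ≤ m * t ^ 2 * l := by
      calc (1 : ℝ) / 4 = 1 * (1 / 2) ^ 2 * 1 := by norm_num
        _ ≤ m * t ^ 2 * l := by gcongr
    have h3 : 1 ≤ 2 * (d * td) := by nlinarith
    calc (Φ.depth : ℝ) ≤ 148 * (m * t ^ 2 * l) := by linarith
      _ ≤ 148 * (m * t ^ 2 * l) * (2 * (d * td)) := le_mul_of_one_le_right (by positivity) h3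
      _ = 296 * (m * t ^ 2 * d * td * l) := by ring
      _ ≤ 200000 * (m * t ^ 2 * d * td * l) := by gcongr; norm_num
      _ = _ := by ring
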